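/- Let $d\in\mathbb N$, let $V:\mathbb R^d\to\mathbb R$ be smooth with $Z=\int_{\mathbb R^d} e^{-V}\,dx<\infty$, let $\pi(dx)=Z^{-1}e^{-V(x)}\,dx$, and let $g:\mathbb R^d\to\mathbb R^d$ be a smooth vector field with $\operatorname{div}(g\pi)=0$. Let $\mathcal L$ be the generator of the overdamped Langevin dynamics $dX=-\nabla V(X)\,dt+\sqrt2\,dW_t$, that is $\mathcal L\varphi=-\nabla V\cdot\nabla\varphi+\Delta\varphi$, and let $\mathcal L_S$ be the generator of the Stratonovich-perturbed dynamics $dX=-\nabla V(X)\,dt+g(X)\circ\sqrt2\,d\beta_t+\sqrt2\,dW_t$ (with $W$ and $\beta$ independent Brownian motions of dimension $d$ and $1$), that is, the generator of the Itô equation with drift $-\nabla V+g'g$ and diffusion matrix $\sqrt2\,(I,g)$. Both are regarded as self-adjoint operators in $L^2(\pi)$, namely the Friedrichs extensions of these differential operators on the smooth functions that are constant outside a compact set. For $\mathcal G\in\{\mathcal L,\mathcal L_S\}$ the spectral gap is the infimum of the spectrum of $-\mathcal G$ on $L^2_0(\pi)=\{u\in L^2(\pi):\int u\,d\pi=0\}$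 (taken to be $0$ if this spectrum is empty, which happens only for $d=0$), and for $\varphi\in L^2(\pi)$ the (Kipnis–Varadhan) asymptotic variance is $\langle\varphi-\pi(\varphi),(-\mathcal G)^{-1}(\varphi-\pi(\varphi))\rangle_\pi$, with $\pi(\varphi)=\int\varphi\,d\pi$, where $(-\mathcal G)^{-1}(\varphi-\pi(\varphi))$ denotes the solution $\psi\in L^2_0(\pi)$ of $-\mathcal G\psi=\varphi-\pi(\varphi)$. Denote the spectral gaps of $\mathcal L$ and $\mathcal L_S$ by $\lambda_L,\lambda_S$ and the asymptotic variances by $\sigma_L^2(\varphi),\sigma_S^2(\varphi)$. Then $$\lambda_L\le\lambda_S ,$$ and, for every $\varphi\in L^2(\pi)$ for which both asymptotic variances are defined, $$\sigma_L^2(\varphi)\ge\sigma_S^2(\varphi).$$ If $\lambda_L>0$, then both asymptotic variances are defined, uniquely, for every $\varphi\in L^2(\pi)$. -/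

import Mathlib

open MeasureTheory Filter Topology
open scoped ContDiff

noncomputable section

namespace StratonovichLangevin

/-- The state space `ℝ^d` with its Euclidean structure. -/
abbrev E (d : ℕ) : Type := EuclideanSpace ℝ (Fin d)

/-- The normalized density `π(x) = Z⁻¹ e^{-V(x)}`, `Z = ∫ e^{-V(x)} dx`. -/
def gibbsDensity {d : ℕ} (V : E d → ℝ) (x : E d) : ℝ :=
  (∫ y, Real.exp (-V y))⁻¹ * Real.exp (-V x)

/-- The measure `π(dx) = Z⁻¹ e^{-V(x)} dx`. -/
def gibbsMeasure {d : ℕ} (V : E d → ℝ) : Measure (E d) :=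
  volume.withDensity fun x => ENNReal.ofReal (gibbsDensity V x)

instance gibbsMeasure_isFiniteMeasure {d : ℕ} (V : E d → ℝ) :
    IsFiniteMeasure (gibbsMeasure V) := by
  have h : Integrable (gibbsDensity V) := by
    by_cases hi : Integrable fun x => Real.exp (-V x)
    · exact hi.const_mul _
    · have h0 : gibbsDensity V = fun _ => 0 := by
        funext x
        simp [gibbsDensity, integral_undef hi]
      rw [h0]
      exact integrable_zero _ _ _
  exact isFiniteMeasure_withDensity_ofReal h.2

/-- The divergence `∑ᵢ ∂ᵢ Fᵢ` of a vector field. -/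
def divergence {d : ℕ} (F : E d → E d) (x : E d) : ℝ :=
  ∑ i : Fin d, (fderiv ℝ F x (EuclideanSpace.single i 1)) i

/-! ### Generators of stochastic differential equations -/

/-- The generator `𝓛φ = b · ∇φ + ½ σσᵀ : ∇²φ` of the Itô equation
`dX = b(X) dt + ∑ₖ σₖ(X) dBᵏ`, where `σₖ` is the `k`-th column of `σ`. -/
def itoGenerator {d : ℕ} {ι : Type} [Fintype ι] (b : E d → E d) (σ : ι → E d → E d)
    (φ : E d → ℝ) (x : E d) : ℝ :=
  fderiv ℝ φ x (b x) + (1 / 2) * ∑ k, fderiv ℝ (fderiv ℝ φ) x (σ k x) (σ k x)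

/-- The Itô drift `f + ½ ∑ₖ σₖ' σₖ` of the Stratonovich equation
`dX = f(X) dt + ∑ₖ σₖ(X) ∘ dBᵏ`. -/
def stratonovichDrift {d : ℕ} {ι : Type} [Fintype ι] (f : E d → E d) (σ : ι → E d → E d)
    (x : E d) : E d :=
  f x + (1 / 2 : ℝ) • ∑ k, fderiv ℝ (σ k) x (σ k x)

/-- The noise `√2 dW`, with `W` a `d`-dimensional Brownian motion. -/
def langevinNoise (d : ℕ) (k : Fin d) (_x : E d) : E d :=
  √2 • EuclideanSpace.single k 1

/-- The noise `g(X) ∘ √2 dβ + √2 dW`; the index `none` belongs to `β`. The second part is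
additive, so its Itô and Stratonovich readings agree. -/
def perturbedNoise {d : ℕ} (g : E d → E d) : Option (Fin d) → E d → E d
  | none => fun x => √2 • g x
  | some k => langevinNoise d k

/-- The generator of `dX = -∇V(X) dt + √2 dW`. -/
def langevinOperator {d : ℕ} (V : E d → ℝ) : (E d → ℝ) → E d → ℝ :=
  itoGenerator (fun x => -gradient V x) (langevinNoise d)

/-- The generator of `dX = -∇V(X) dt + g(X) ∘ √2 dβ + √2 dW`. -/
def perturbedOperator {d : ℕ} (V : E d → ℝ) (g : E d → E d) : (E d → ℝ) → E d → ℝ :=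
  itoGenerator (stratonovichDrift (fun x => -gradient V x) (perturbedNoise g)) (perturbedNoise g)

/-! ### Realization in `L²(π)` -/

/-- Smooth functions that are constant outside a compact set, that is, `C_c^∞ + ℝ`. -/
def IsTest {d : ℕ} (v : E d → ℝ) : Prop :=
  ContDiff ℝ ∞ v ∧ ∃ c : ℝ, HasCompactSupport fun x => v x - c

/-- The quadratic form `⟨-𝓛 v, v⟩_π` on test functions. -/
def energy {d : ℕ} (π : Measure (E d)) (𝓛 : (E d → ℝ) → E d → ℝ) (v : E d → ℝ) : ℝ :=
  ∫ x, -(𝓛 v x) * v x ∂π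

/-- The graph of the `L²(π)` generator: the Friedrichs extension of the differential operator `𝓛`
on test functions. A pair `(u, w)` belongs to it, meaning that `u` is in the domain and `𝓛 u = w`,
if `u` lies in the closure of the test functions for the norm of the form `⟨-𝓛 v, v⟩_π + ‖v‖²_π`,
and `⟨u, 𝓛 v⟩_π = ⟨w, v⟩_π` for every test function `v`. -/
def generatorGraph {d : ℕ} (π : Measure (E d)) (𝓛 : (E d → ℝ) → E d → ℝ) :
    Set (Lp ℝ 2 π × Lp ℝ 2 π) :=
  {p | (∃ v : ℕ → E d → ℝ, (∀ n, IsTest (v n)) ∧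
          Tendsto (fun n => eLpNorm (fun x => v n x - p.1 x) 2 π) atTop (𝓝 0) ∧
          Tendsto (fun q : ℕ × ℕ => energy π 𝓛 (fun x => v q.1 x - v q.2 x)) atTop (𝓝 0)) ∧
       ∀ v : E d → ℝ, IsTest v → ∫ x, p.1 x * 𝓛 v x ∂π = ∫ x, p.2 x * v x ∂π}

/-- The closed subspace of the functions in `L²(π)` with mean zero. -/
def meanZero {d : ℕ} (π : Measure (E d)) [IsFiniteMeasure π] : Submodule ℝ (Lp ℝ 2 π) where
  carrier := {u | ∫ x, u x ∂π = 0}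
  zero_mem' := by
    have h : ∫ x, (0 : Lp ℝ 2 π) x ∂π = ∫ _x : E d, (0 : ℝ) ∂π :=
      integral_congr_ae (Lp.coeFn_zero ℝ 2 π)
    simpa using h
  add_mem' := by
    intro u v hu hv
    have hu1 : Integrable u π := (Lp.memLp u).integrable (by norm_num)
    have hv1 : Integrable v π := (Lp.memLp v).integrable (by norm_num)
    have h : ∫ x, (u + v : Lp ℝ 2 π) x ∂π = ∫ x, (u x + v x) ∂π :=
      integral_congr_ae (Lp.coeFn_add u v)
    simp only [Set.mem_ofPred_eq] at hu hv ⊢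
    rw [h, integral_add hu1 hv1, hu, hv, add_zero]
  smul_mem' := by
    intro c u hu
    have h : ∫ x, (c • u : Lp ℝ 2 π) x ∂π = ∫ x, c * u x ∂π :=
      integral_congr_ae (Lp.coeFn_smul c u)
    simp only [Set.mem_ofPred_eq] at hu ⊢
    rw [h, integral_const_mul, hu, mul_zero]

/-- The spectrum of `-𝓛` on the mean-zero subspace of `L²(π)`, where `𝓛` is the operator with graph
`G`: the real numbers `μ` for which `-𝓛 - μ` has no bounded everywhere defined inverse `R`. -/
def meanZeroSpectrum {d : ℕ} (π : Measure (E d)) [IsFiniteMeasure π]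
    (G : Set (Lp ℝ 2 π × Lp ℝ 2 π)) : Set ℝ :=
  {μ | ¬ ∃ R : meanZero π →L[ℝ] meanZero π, ∀ u h : meanZero π,
      R h = u ↔ ∃ w : Lp ℝ 2 π, ((u : Lp ℝ 2 π), w) ∈ G ∧
        -w - μ • (u : Lp ℝ 2 π) = (h : Lp ℝ 2 π)}

/-- The `L²(π)` spectral gap: the bottom of the spectrum of `-𝓛` on the orthogonal complement of
the constants. -/
def spectralGap {d : ℕ} (π : Measure (E d)) [IsFiniteMeasure π]
    (G : Set (Lp ℝ 2 π × Lp ℝ 2 π)) : ℝ :=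
  sInf (meanZeroSpectrum π G)

/-- The centred observable `φ - π(φ)`. -/
def centred {d : ℕ} (π : Measure (E d)) [IsFiniteMeasure π] (φ : Lp ℝ 2 π) : Lp ℝ 2 π :=
  φ - Lp.const 2 π (∫ x, φ x ∂π)

/-- `s = ⟨φ - π(φ), (-𝓛)⁻¹ (φ - π(φ))⟩_π`, where `ψ = (-𝓛)⁻¹ (φ - π(φ))` is the mean-zero solution
of the Poisson equation `-𝓛 ψ = φ - π(φ)`. -/
def HasAsymptoticVariance {d : ℕ} (π : Measure (E d)) [IsFiniteMeasure π]
    (G : Set (Lp ℝ 2 π × Lp ℝ 2 π)) (φ : Lp ℝ 2 π) (s : ℝ) : Prop :=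
  ∃ ψ ∈ meanZero π, ∃ w : Lp ℝ 2 π, (ψ, w) ∈ G ∧ -w = centred π φ ∧
    s = inner ℝ (centred π φ) ψ

/-- The `L²(π)` generator of the overdamped Langevin dynamics. -/
def langevinGraph {d : ℕ} (V : E d → ℝ) :
    Set (Lp ℝ 2 (gibbsMeasure V) × Lp ℝ 2 (gibbsMeasure V)) :=
  generatorGraph (gibbsMeasure V) (langevinOperator V)

/-- The `L²(π)` generator of the Stratonovich-perturbed dynamics. -/
def perturbedGraph {d : ℕ} (V : E d → ℝ) (g : E d → E d) :
    Set (Lp ℝ 2 (gibbsMeasure V) × Lp ℝ 2 (gibbsMeasure V)) :=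
  generatorGraph (gibbsMeasure V) (perturbedOperator V g)

end StratonovichLangevin

end

noncomputable section

namespace StratonovichLangevin

universe u

/-! ### Friedrichs extensions of nonnegative symmetric operators -/

section Abstract

open scoped InnerProductSpace

variable {H T : Type*} [NormedAddCommGroup H] [InnerProductSpace ℝ H]
  [AddCommGroup T] [Module ℝ T]

/-! The perturbation only adds a nonnegative term to the Dirichlet form. In Stratonovich form a
generator reads `f · ∇ + ½ ∑ₖ (σₖ · ∇)²`, and integration by parts against a density `ρ` gives the
form `½ ∑ₖ ∫ ρ (σₖ · ∇v)²` as soon as `ρ f = ½ ∑ₖ div(ρ σₖ) σₖ`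
(`IsTest.integral_neg_itoGenerator_mul`). For `f = -∇V` and the noise `√2 dW` this condition is `∇ρ
= -ρ ∇V`; the extra column `√2 g` does not change it, because `div(g π) = 0`. So both operators are
symmetric on the same test functions, and the forms differ by `∫ (g · ∇v)² dπ ≥ 0`.

The rest is Hilbert space theory. Let `P` remove the component along the constants. The form `⟨A v,
v⟩ - μ ‖P v‖²`, when nonnegative, is completed to a Hilbert space `K`. Strictly below a lower bound
of the form, Riesz representation in `K` yields the resolvent; conversely, a resolvent at a lower
bound improves that bound. Hence the spectral gap is the best Poincaré constant
(`isLeast_spectrumOn`), which is monotone in the form. The asymptotic variance `⟨h, A⁻¹ h⟩` is the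
squared norm of `h` as a functional on the form space, and a larger form has a smaller dual norm
(`inner_le_inner_of_form_le`). Closability of the form is never needed: the weak equation in the
graph already determines the limit in `K`. -/

/-- A nonnegative symmetric bilinear form is the pullback of the inner product of a Hilbert space
along a linear map with dense range. -/
theorem exists_hilbert_completion {T : Type u} [AddCommGroup T] [Module ℝ T]
    (B : T →ₗ[ℝ] T →ₗ[ℝ] ℝ) (hs : ∀ v w, B v w = B w v) (hp : ∀ v, 0 ≤ B v v) :
    ∃ (K : Type u) (_ : NormedAddCommGroup K) (_ : InnerProductSpace ℝ K) (_ : CompleteSpace K)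
      (j : T →ₗ[ℝ] K), DenseRange j ∧ ∀ v w, ⟪j v, j w⟫_ℝ = B v w := by
  let c : PreInnerProductSpace.Core ℝ T :=
    { inner := fun v w => B v w
      conj_inner_symm := fun v w => by simpa using hs w v
      re_inner_nonneg := fun v => by simpa using hp v
      add_left := fun x y z => by simp
      smul_left := fun x y r => by simp }
  let _ : SeminormedAddCommGroup T := InnerProductSpace.Core.toSeminormedAddCommGroup (c := c)
  let _ : InnerProductSpace ℝ T := InnerProductSpace.ofCore c
  -- The completion is Hausdorff, so null vectors of the semidefinite form are sent to zero.
  refine ⟨UniformSpace.Completion T, inferInstance, inferInstance, inferInstance,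
    (UniformSpace.Completion.toComplL (𝕜 := ℝ) (E := T)).toLinearMap, ?_, ?_⟩
  · exact UniformSpace.Completion.denseRange_coe
  · intro v w
    exact UniformSpace.Completion.inner_coe v w

/-- A nonnegative symmetric operator `A` on a space of test functions `T`, mapped to the Hilbert
space by `ι`, which annihilates the test function `e`. -/
structure DirichletOperator (ι : T →ₗ[ℝ] H) (e : T) where
  /-- The operator, as a map from test functions to the Hilbert space. -/
  toLinearMap : T →ₗ[ℝ] H
  symm : ∀ v w, ⟪toLinearMap v, ι w⟫_ℝ = ⟪ι v, toLinearMap w⟫_ℝ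
  nonneg : ∀ v, 0 ≤ ⟪toLinearMap v, ι v⟫_ℝ
  map_one : toLinearMap e = 0

/-- The component of a test function orthogonal to `e`. -/
def orthogonalPart (ι : T →ₗ[ℝ] H) (e : T) : T →ₗ[ℝ] T :=
  LinearMap.id - ((innerₗ H (ι e)).comp ι).smulRight e

theorem orthogonalPart_apply (ι : T →ₗ[ℝ] H) (e v : T) :
    orthogonalPart ι e v = v - ⟪ι e, ι v⟫_ℝ • e := by
  simp [orthogonalPart]

theorem inner_orthogonalPart (ι : T →ₗ[ℝ] H) {e : T} (he : ‖ι e‖ = 1) (v : T) :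
    ⟪ι e, ι (orthogonalPart ι e v)⟫_ℝ = 0 := by
  simp [orthogonalPart_apply, inner_sub_right, inner_smul_right, he]

namespace DirichletOperator

variable {ι : T →ₗ[ℝ] H} {e : T} (D : DirichletOperator ι e)

/-- The graph of the negative of the Friedrichs extension of `A`. -/
def graph : Set (H × H) :=
  {p | (∃ v : ℕ → T, Tendsto (fun n => ι (v n)) atTop (𝓝 p.1) ∧
      Tendsto (fun q : ℕ × ℕ => ⟪D.toLinearMap (v q.1 - v q.2), ι (v q.1 - v q.2)⟫_ℝ)
        atTop (𝓝 0)) ∧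
    ∀ v, ⟪p.1, D.toLinearMap v⟫_ℝ = -⟪p.2, ι v⟫_ℝ}

/-- The form of the operator, shifted by `μ` on the orthogonal complement of `e`. -/
def shiftedForm (μ : ℝ) : T →ₗ[ℝ] T →ₗ[ℝ] ℝ :=
  (innerₗ H).compl₁₂ D.toLinearMap ι -
    μ • (innerₗ H).compl₁₂ (ι.comp (orthogonalPart ι e)) (ι.comp (orthogonalPart ι e))

theorem shiftedForm_apply (μ : ℝ) (v w : T) : D.shiftedForm μ v w =
    ⟪D.toLinearMap v, ι w⟫_ℝ - μ * ⟪ι (orthogonalPart ι e v), ι (orthogonalPart ι e w)⟫_ℝ := by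
  simp [shiftedForm]

theorem shiftedForm_self (μ : ℝ) (v : T) : D.shiftedForm μ v v =
    ⟪D.toLinearMap v, ι v⟫_ℝ - μ * ‖ι (orthogonalPart ι e v)‖ ^ 2 := by
  rw [shiftedForm_apply, real_inner_self_eq_norm_sq]

theorem shiftedForm_comm (μ : ℝ) (v w : T) : D.shiftedForm μ v w = D.shiftedForm μ w v := by
  rw [shiftedForm_apply, shiftedForm_apply, D.symm, real_inner_comm,
    real_inner_comm (ι (orthogonalPart ι e v))]

/-- `μ` is a lower bound of the form on the orthogonal complement of `e`. -/
def IsLowerBound (μ : ℝ) : Prop :=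
  ∀ v, μ * ‖ι (orthogonalPart ι e v)‖ ^ 2 ≤ ⟪D.toLinearMap v, ι v⟫_ℝ

theorem isLowerBound_zero : D.IsLowerBound 0 := fun v => by simpa using D.nonneg v

/-- The set of real numbers `μ` for which `A - μ` has no bounded inverse on `M`. -/
def spectrumOn (M : Submodule ℝ H) : Set ℝ :=
  {μ | ¬ ∃ R : M →L[ℝ] M, ∀ u h : M,
      R h = u ↔ ∃ w : H, ((u : H), w) ∈ D.graph ∧ -w - μ • (u : H) = (h : H)}

/-! ### Graph elements as limits in the form space -/

theorem tendsto_orthogonalPart {v : ℕ → T} {u : H} (hu : ⟪ι e, u⟫_ℝ = 0)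
    (hv : Tendsto (fun n => ι (v n)) atTop (𝓝 u)) :
    Tendsto (fun n => ι (orthogonalPart ι e (v n))) atTop (𝓝 u) := by
  have h1 : Tendsto (fun n => ⟪ι e, ι (v n)⟫_ℝ) atTop (𝓝 0) := by
    rw [← hu]
    exact tendsto_const_nhds.inner hv
  have h2 := hv.sub (h1.smul_const (ι e))
  simpa [orthogonalPart_apply] using h2

/-- Testing the weak equation against `e`, which the operator annihilates, shows that `p.2` is
orthogonal to `e`. -/
theorem inner_orthogonalPart_of_mem_graph {p : H × H} (hp : p ∈ D.graph) (x : T) :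
    ⟪p.2, ι (orthogonalPart ι e x)⟫_ℝ = ⟪p.2, ι x⟫_ℝ := by
  have h := hp.2 e
  rw [D.map_one, inner_zero_right] at h
  rw [orthogonalPart_apply, map_sub, map_smul, inner_sub_right, inner_smul_right]
  linear_combination -⟪ι e, ι x⟫_ℝ * h

theorem exists_tendsto_of_form_tendsto {K : Type*} [NormedAddCommGroup K]
    [InnerProductSpace ℝ K] [CompleteSpace K] {j : T →ₗ[ℝ] K} {v : ℕ → T}
    (h : Tendsto (fun q : ℕ × ℕ => ⟪j (v q.1 - v q.2), j (v q.1 - v q.2)⟫_ℝ) atTop (𝓝 0)) :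
    ∃ k, Tendsto (fun n => j (v n)) atTop (𝓝 k) := by
  apply cauchySeq_tendsto_of_complete
  rw [cauchySeq_iff_tendsto_dist_atTop_0]
  have h' := h.sqrt
  rw [Real.sqrt_zero] at h'
  refine h'.congr fun q => ?_
  rw [real_inner_self_eq_norm_sq, Real.sqrt_sq (norm_nonneg _), dist_eq_norm, map_sub]

/-- An element of the graph orthogonal to `e` is the limit, in the form sense, of test functions,
and its limit in the form space represents `-w - μ u`. -/
theorem exists_tendsto_of_mem_graph {K : Type*} [NormedAddCommGroup K]
    [InnerProductSpace ℝ K] [CompleteSpace K] {j : T →ₗ[ℝ] K} {μ : ℝ}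
    (hj : ∀ v w, ⟪j v, j w⟫_ℝ = D.shiftedForm μ v w) {u w : H} (huw : (u, w) ∈ D.graph)
    (hu : ⟪ι e, u⟫_ℝ = 0) :
    ∃ (v : ℕ → T) (k : K), Tendsto (fun n => ι (orthogonalPart ι e (v n))) atTop (𝓝 u) ∧
      Tendsto (fun n => j (v n)) atTop (𝓝 k) ∧
      ∀ x, ⟪k, j x⟫_ℝ = ⟪-w - μ • u, ι (orthogonalPart ι e x)⟫_ℝ := by
  obtain ⟨v, hv, hE⟩ := huw.1
  have hPv := tendsto_orthogonalPart hu hv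
  have hc : Tendsto (fun q : ℕ × ℕ => ⟪j (v q.1 - v q.2), j (v q.1 - v q.2)⟫_ℝ) atTop (𝓝 0) := by
    have h1 := (cauchySeq_iff_tendsto_dist_atTop_0.1 hPv.cauchySeq)
    have h2 := hE.sub ((h1.pow 2).const_mul μ)
    simp only [ne_eq, OfNat.ofNat_ne_zero, not_false_eq_true, zero_pow, mul_zero, sub_zero] at h2
    refine h2.congr fun q => ?_
    rw [hj, shiftedForm_self, dist_eq_norm, ← map_sub, ← map_sub]
  obtain ⟨k, hk⟩ := exists_tendsto_of_form_tendsto hc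
  refine ⟨v, k, hPv, hk, fun x => ?_⟩
  have h1 : Tendsto (fun n => ⟪j (v n), j x⟫_ℝ) atTop (𝓝 ⟪k, j x⟫_ℝ) :=
    hk.inner tendsto_const_nhds
  have h2 : Tendsto (fun n => ⟪j (v n), j x⟫_ℝ) atTop
      -- Only convergence in `H` is available for `v n`, so symmetry moves the operator onto the
      -- fixed `x` before the limit is taken.
      (𝓝 (⟪u, D.toLinearMap x⟫_ℝ - μ * ⟪u, ι (orthogonalPart ι e x)⟫_ℝ)) := by
    have h3 := (hv.inner (tendsto_const_nhds (x := D.toLinearMap x))).sub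
      ((hPv.inner (tendsto_const_nhds (x := ι (orthogonalPart ι e x)))).const_mul μ)
    refine h3.congr fun n => ?_
    rw [hj, shiftedForm_apply, D.symm]
  rw [tendsto_nhds_unique h1 h2, huw.2 x]
  have h4 := D.inner_orthogonalPart_of_mem_graph huw x
  simp only at h4 ⊢
  rw [inner_sub_left, inner_neg_left, h4, inner_smul_left]
  simp

/-- Below a strict lower bound of the form, the resolvent exists. -/
theorem notMem_spectrumOn_of_lt [CompleteSpace H] (he : ‖ι e‖ = 1) {M : Submodule ℝ H}
    (hM : ∀ u, u ∈ M ↔ ⟪ι e, u⟫_ℝ = 0) {μ m : ℝ} (hμ : μ < m) (hm : D.IsLowerBound m) :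
    μ ∉ D.spectrumOn M := by
  have hpos : ∀ v, (m - μ) * ‖ι (orthogonalPart ι e v)‖ ^ 2 ≤ D.shiftedForm μ v v := by
    intro v
    have := hm v
    rw [shiftedForm_self]
    linarith
  obtain ⟨K, _, _, _, j, hd, hj⟩ := exists_hilbert_completion (D.shiftedForm μ)
    (D.shiftedForm_comm μ) fun v => le_trans (by have := sub_pos.2 hμ; positivity) (hpos v)
  have hMc : IsClosed (M : Set H) := by
    have : (M : Set H) = {u | ⟪ι e, u⟫_ℝ = 0} := Set.ext hM
    rw [this]
    exact isClosed_eq (by fun_prop) continuous_const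
  have : CompleteSpace M := hMc.completeSpace_coe
  let i : T →ₗ[ℝ] M := (ι.comp (orthogonalPart ι e)).codRestrict M
    fun v => (hM _).2 (inner_orthogonalPart ι he v)
  have hi : ∀ v, (i v : H) = ι (orthogonalPart ι e v) := fun v => rfl
  -- Coercivity with constant `m - μ` bounds `i` by the form norm, so `i` extends to a bounded map
  -- `J` from the form space to `M`.
  have hbound : ∃ C, ∀ v, ‖i v‖ ≤ C * ‖j v‖ := by
    refine ⟨√((m - μ)⁻¹), fun v => ?_⟩
    rw [← Real.sqrt_sq (norm_nonneg (j v)), ← Real.sqrt_mul (by simpa using hμ.le)]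
    apply Real.le_sqrt_of_sq_le
    rw [← real_inner_self_eq_norm_sq (j v), hj]
    have h1 := hpos v
    have h2 : 0 < m - μ := sub_pos.2 hμ
    rw [le_inv_mul_iff₀ h2]
    exact h1
  let J : K →L[ℝ] M := i.extendOfNorm j
  have hJ : ∀ v, J (j v) = i v := LinearMap.extendOfNorm_eq hd hbound
  -- The resolvent is `J J*`: the vector `J* h` is the Riesz representative of `x ↦ ⟨h, P x⟩` in the
  -- form space, and `J` carries it back to `M`.
  refine fun hμs => hμs ⟨J.comp (ContinuousLinearMap.adjoint J), fun u h => ⟨?_, ?_⟩⟩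
  · rintro rfl
    set k := ContinuousLinearMap.adjoint J h with hk
    have hkx : ∀ x, ⟪k, j x⟫_ℝ = ⟪(h : H), ι (orthogonalPart ι e x)⟫_ℝ := by
      intro x
      rw [hk, ContinuousLinearMap.adjoint_inner_left, hJ]
      rfl
    obtain ⟨y, hy, hyk⟩ := mem_closure_iff_seq_limit.1 (hd k)
    choose v hv using hy
    have hvk : Tendsto (fun n => j (v n)) atTop (𝓝 k) := by simpa [hv] using hyk
    have hlim : Tendsto (fun n => ι (orthogonalPart ι e (v n))) atTop (𝓝 (J k : H)) := by
      have h1 := (M.subtypeL.continuous.tendsto _).comp ((J.continuous.tendsto k).comp hvk)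
      refine h1.congr fun n => ?_
      simp [hJ, hi]
    refine ⟨-(h : H) - μ • (J k : H), ⟨?_, ?_⟩, by simp [hk]⟩
    -- The `e`-components of `v n` are not controlled by the form, so they are removed; this leaves
    -- the energy unchanged because the operator kills `e`.
    · refine ⟨fun n => orthogonalPart ι e (v n), hlim, ?_⟩
      have h1 := cauchySeq_iff_tendsto_dist_atTop_0.1 hlim.cauchySeq
      have h2 := cauchySeq_iff_tendsto_dist_atTop_0.1 hvk.cauchySeq
      have h3 := (h2.pow 2).add ((h1.pow 2).const_mul μ)
      simp only [ne_eq, OfNat.ofNat_ne_zero, not_false_eq_true, zero_pow, mul_zero, add_zero]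
        at h3
      refine h3.congr fun q => ?_
      have hA : ∀ x, ⟪D.toLinearMap (orthogonalPart ι e x), ι (orthogonalPart ι e x)⟫_ℝ =
          ⟪D.toLinearMap x, ι x⟫_ℝ := by
        intro x
        have h5 : D.toLinearMap (orthogonalPart ι e x) = D.toLinearMap x := by
          rw [orthogonalPart_apply, map_sub, map_smul, D.map_one]
          simp
        rw [D.symm, h5, ← D.symm, h5]
      rw [← map_sub (orthogonalPart ι e), hA, dist_eq_norm, dist_eq_norm, ← map_sub, ← map_sub,
        ← map_sub, ← real_inner_self_eq_norm_sq, hj, shiftedForm_self]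
      ring
    · intro x
      have horth : ∀ y : M, ⟪(y : H), ι (orthogonalPart ι e x)⟫_ℝ = ⟪(y : H), ι x⟫_ℝ := by
        intro y
        have hy := (hM _).1 y.2
        rw [real_inner_comm] at hy
        simp [orthogonalPart_apply, inner_sub_right, inner_smul_right, hy]
      have h1 : Tendsto (fun n => ⟪ι (orthogonalPart ι e (v n)), D.toLinearMap x⟫_ℝ) atTop
          (𝓝 (⟪k, j x⟫_ℝ + μ * ⟪(J k : H), ι (orthogonalPart ι e x)⟫_ℝ)) := by
        have h2 := (hvk.inner (tendsto_const_nhds (x := j x))).add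
          ((hlim.inner (tendsto_const_nhds (x := ι (orthogonalPart ι e x)))).const_mul μ)
        refine h2.congr fun n => ?_
        have h3 : ⟪ι e, D.toLinearMap x⟫_ℝ = 0 := by rw [← D.symm, D.map_one, inner_zero_left]
        rw [hj, shiftedForm_apply, D.symm, orthogonalPart_apply ι e (v n), map_sub, map_smul,
          inner_sub_left (ι (v n)) _ (D.toLinearMap x), real_inner_smul_left _ (D.toLinearMap x), h3]
        ring
      change ⟪(J k : H), _⟫_ℝ = -⟪-(h : H) - μ • (J k : H), _⟫_ℝ
      rw [tendsto_nhds_unique (hlim.inner (tendsto_const_nhds (x := D.toLinearMap x))) h1, hkx,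
        horth, horth, inner_sub_left, inner_neg_left, real_inner_smul_left]
      ring
  · rintro ⟨w, huw, hw⟩
    obtain ⟨v, k, hvu, hvk, hkx⟩ := D.exists_tendsto_of_mem_graph hj huw ((hM _).1 u.2)
    -- Both vectors represent the same functional on the dense range of `j`. This identifies the
    -- form limit of an arbitrary approximating sequence.
    have hkeq : ContinuousLinearMap.adjoint J h = k := by
      have hd' : Dense (Set.range j) := hd
      refine hd'.eq_of_inner_left (𝕜 := ℝ) ?_
      rintro _ ⟨x, rfl⟩
      rw [ContinuousLinearMap.adjoint_inner_left, hJ, hkx, hw]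
      rfl
    have h1 : Tendsto (fun n => (i (v n) : H)) atTop (𝓝 (J k : H)) := by
      have h2 := (M.subtypeL.continuous.tendsto _).comp ((J.continuous.tendsto k).comp hvk)
      refine h2.congr fun n => ?_
      simp [hJ]
    apply Subtype.ext
    rw [ContinuousLinearMap.comp_apply, hkeq]
    exact tendsto_nhds_unique h1 hvu

/-- If the resolvent exists at a lower bound of the form, the lower bound is not optimal. -/
theorem exists_lt_isLowerBound (he : ‖ι e‖ = 1) {M : Submodule ℝ H}
    (hM : ∀ u, u ∈ M ↔ ⟪ι e, u⟫_ℝ = 0) {μ : ℝ} (hμ : D.IsLowerBound μ)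
    (hs : μ ∉ D.spectrumOn M) : ∃ m, μ < m ∧ D.IsLowerBound m := by
  obtain ⟨R, hR⟩ := not_not.1 hs
  obtain ⟨K, _, _, _, j, hd, hj⟩ := exists_hilbert_completion (D.shiftedForm μ)
    (D.shiftedForm_comm μ) fun v => by rw [shiftedForm_self]; linarith [hμ v]
  have hc : 0 < ‖R‖ + 1 := by positivity
  -- Adding `1` keeps the constant invertible when `R = 0`.
  refine ⟨μ + (‖R‖ + 1)⁻¹, by simpa using hc, fun v => ?_⟩
  let h : M := ⟨ι (orthogonalPart ι e v), (hM _).2 (inner_orthogonalPart ι he v)⟩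
  obtain ⟨w, huw, hw⟩ := (hR (R h) h).1 rfl
  obtain ⟨y, k, hyu, hyk, hkx⟩ := D.exists_tendsto_of_mem_graph hj huw ((hM _).1 (R h).2)
  rw [hw] at hkx
  have hkk : ⟪k, k⟫_ℝ = ⟪(h : H), (R h : H)⟫_ℝ :=
    tendsto_nhds_unique ((tendsto_const_nhds (x := k)).inner hyk)
      (((tendsto_const_nhds (x := (h : H))).inner hyu).congr fun n => (hkx _).symm)
  have hv : ‖(h : H)‖ ^ 2 = ⟪k, j v⟫_ℝ := by
    rw [hkx, ← real_inner_self_eq_norm_sq]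
  have hb : ⟪(h : H), (R h : H)⟫_ℝ ≤ (‖R‖ + 1) * ‖(h : H)‖ ^ 2 := by
    have h1 := real_inner_le_norm (h : H) (R h : H)
    have h2 : ‖(R h : H)‖ ≤ ‖R‖ * ‖(h : H)‖ := R.le_opNorm h
    nlinarith [norm_nonneg (h : H)]
  -- With `h = P v`, Cauchy–Schwarz in the form space gives `‖h‖⁴ ≤ ⟨h, R h⟩ · (⟨A v, v⟩ - μ ‖h‖²)`.
  -- Bounding `⟨h, R h⟩` by `(‖R‖ + 1) ‖h‖²` and cancelling `‖h‖²` gives the improved bound.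
  have hcs := real_inner_mul_inner_self_le k (j v)
  rw [← hv, hkk, hj, shiftedForm_self] at hcs
  change (μ + (‖R‖ + 1)⁻¹) * ‖(h : H)‖ ^ 2 ≤ _
  change _ ≤ _ * (_ - μ * ‖(h : H)‖ ^ 2) at hcs
  have hq : 0 ≤ ⟪D.toLinearMap v, ι v⟫_ℝ - μ * ‖(h : H)‖ ^ 2 := sub_nonneg.2 (hμ v)
  rcases (sq_nonneg ‖(h : H)‖).eq_or_lt with h0 | h0
  · rw [← h0] at hq ⊢
    linarith
  · have h3 : ‖(h : H)‖ ^ 2 ≤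
        (‖R‖ + 1) * (⟪D.toLinearMap v, ι v⟫_ℝ - μ * ‖(h : H)‖ ^ 2) := by
      refine le_of_mul_le_mul_left ?_ h0
      nlinarith [mul_le_mul_of_nonneg_right hb hq]
    have h4 := (inv_mul_le_iff₀ hc).2 h3
    linarith

/-- Comparison of the quadratic forms of the inverses. -/
theorem inner_le_inner_of_form_le {D₁ D₂ : DirichletOperator ι e}
    (hle : ∀ v, ⟪D₁.toLinearMap v, ι v⟫_ℝ ≤ ⟪D₂.toLinearMap v, ι v⟫_ℝ) {u₁ u₂ w : H}
    (h₁ : (u₁, w) ∈ D₁.graph) (h₂ : (u₂, w) ∈ D₂.graph)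
    (hu₁ : ⟪ι e, u₁⟫_ℝ = 0) (hu₂ : ⟪ι e, u₂⟫_ℝ = 0) :
    ⟪-w, u₂⟫_ℝ ≤ ⟪-w, u₁⟫_ℝ := by
  obtain ⟨K₁, _, _, _, j₁, hd₁, hj₁⟩ := exists_hilbert_completion (D₁.shiftedForm 0)
    (D₁.shiftedForm_comm 0) fun v => by simpa [shiftedForm_self] using D₁.nonneg v
  obtain ⟨K₂, _, _, _, j₂, hd₂, hj₂⟩ := exists_hilbert_completion (D₂.shiftedForm 0)
    (D₂.shiftedForm_comm 0) fun v => by simpa [shiftedForm_self] using D₂.nonneg v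
  have hn : ∀ x, ‖j₁ x‖ ≤ ‖j₂ x‖ := by
    intro x
    rw [← sq_le_sq₀ (norm_nonneg _) (norm_nonneg _), ← real_inner_self_eq_norm_sq,
      ← real_inner_self_eq_norm_sq, hj₁, hj₂, shiftedForm_self, shiftedForm_self]
    simpa using hle x
  obtain ⟨v₁, k₁, hv₁, hk₁, hx₁⟩ := D₁.exists_tendsto_of_mem_graph hj₁ h₁ hu₁
  obtain ⟨v₂, k₂, hv₂, hk₂, hx₂⟩ := D₂.exists_tendsto_of_mem_graph hj₂ h₂ hu₂
  -- The larger form controls the smaller one, so the sequence for `D₂` also converges in the form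
  -- space of `D₁`.
  obtain ⟨k, hk⟩ : ∃ k, Tendsto (fun n => j₁ (v₂ n)) atTop (𝓝 k) := by
    apply cauchySeq_tendsto_of_complete
    rw [cauchySeq_iff_tendsto_dist_atTop_0]
    refine squeeze_zero (fun _ => dist_nonneg) (fun q => ?_)
      (cauchySeq_iff_tendsto_dist_atTop_0.1 hk₂.cauchySeq)
    rw [dist_eq_norm, dist_eq_norm, ← map_sub, ← map_sub]
    exact hn _
  simp only [zero_smul, sub_zero] at hx₁ hx₂
  have e₁ : ⟪k₁, k₁⟫_ℝ = ⟪-w, u₁⟫_ℝ :=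
    tendsto_nhds_unique ((tendsto_const_nhds (x := k₁)).inner hk₁)
      (((tendsto_const_nhds (x := -w)).inner hv₁).congr fun n => (hx₁ _).symm)
  have e₂ : ⟪k₂, k₂⟫_ℝ = ⟪-w, u₂⟫_ℝ :=
    tendsto_nhds_unique ((tendsto_const_nhds (x := k₂)).inner hk₂)
      (((tendsto_const_nhds (x := -w)).inner hv₂).congr fun n => (hx₂ _).symm)
  have e₃ : ⟪k₁, k⟫_ℝ = ⟪-w, u₂⟫_ℝ :=
    tendsto_nhds_unique ((tendsto_const_nhds (x := k₁)).inner hk)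
      (((tendsto_const_nhds (x := -w)).inner hv₂).congr fun n => (hx₁ _).symm)
  have hkk : ‖k‖ ≤ ‖k₂‖ := le_of_tendsto_of_tendsto' hk.norm hk₂.norm fun n => hn _
  -- The chain is `‖k₂‖² = ⟨k₁, k⟩ ≤ ‖k₁‖ ‖k‖` with `‖k‖ ≤ ‖k₂‖`, whence `‖k₂‖² ≤ ‖k₁‖²`.
  have hcs := real_inner_le_norm k₁ k
  rw [real_inner_self_eq_norm_sq] at e₁ e₂
  nlinarith [norm_nonneg k, norm_nonneg k₁, norm_nonneg k₂, sq_nonneg (‖k₁‖ - ‖k‖)]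

/-- The best lower bound of the form is the least element of the spectrum. -/
theorem isLeast_spectrumOn [CompleteSpace H] (he : ‖ι e‖ = 1) {M : Submodule ℝ H}
    (hM : ∀ u, u ∈ M ↔ ⟪ι e, u⟫_ℝ = 0) {m : ℝ} (hm : IsGreatest {m | D.IsLowerBound m} m) :
    IsLeast (D.spectrumOn M) m := by
  constructor
  · by_contra h
    obtain ⟨m', hlt, hm'⟩ := D.exists_lt_isLowerBound he hM hm.1 h
    exact absurd (hm.2 hm') (not_le.2 hlt)
  · intro μ hμ
    by_contra h
    exact D.notMem_spectrumOn_of_lt he hM (not_le.1 h) hm.1 hμ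

/-- The Rayleigh quotient of `v` bounds every lower bound, and lower bounds form a closed set, so
the supremum is attained. -/
theorem exists_isGreatest_isLowerBound {v : T} (hv : ι (orthogonalPart ι e v) ≠ 0) :
    ∃ m, IsGreatest {m | D.IsLowerBound m} m := by
  have hne : {m | D.IsLowerBound m}.Nonempty := ⟨0, D.isLowerBound_zero⟩
  have hb : BddAbove {m | D.IsLowerBound m} := by
    refine ⟨⟪D.toLinearMap v, ι v⟫_ℝ / ‖ι (orthogonalPart ι e v)‖ ^ 2, fun m hm => ?_⟩
    rw [le_div_iff₀ (by positivity)]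
    exact hm v
  have hcl : IsClosed {m | D.IsLowerBound m} := by
    simp only [IsLowerBound, Set.ofPred_forall]
    exact isClosed_iInter fun v => isClosed_le (by fun_prop) continuous_const
  exact ⟨_, hcl.csSup_mem hne hb, fun m hm => le_csSup hb hm⟩

theorem spectrumOn_eq_empty [CompleteSpace H] (he : ‖ι e‖ = 1) {M : Submodule ℝ H}
    (hM : ∀ u, u ∈ M ↔ ⟪ι e, u⟫_ℝ = 0) (hv : ∀ v, ι (orthogonalPart ι e v) = 0) :
    D.spectrumOn M = ∅ := by
  refine Set.eq_empty_of_forall_notMem fun μ =>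
    D.notMem_spectrumOn_of_lt he hM (lt_add_one μ) fun v => ?_
  simpa [hv v] using D.nonneg v

/-- The bottom of the spectrum is monotone in the form. -/
theorem sInf_spectrumOn_le [CompleteSpace H] (he : ‖ι e‖ = 1) {M : Submodule ℝ H}
    (hM : ∀ u, u ∈ M ↔ ⟪ι e, u⟫_ℝ = 0) {D₁ D₂ : DirichletOperator ι e}
    (hle : ∀ v, ⟪D₁.toLinearMap v, ι v⟫_ℝ ≤ ⟪D₂.toLinearMap v, ι v⟫_ℝ) :
    sInf (D₁.spectrumOn M) ≤ sInf (D₂.spectrumOn M) := by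
  -- Whether the complement of `e` is trivial does not depend on the operator. If it is, both
  -- spectra are empty and both infima take the default value `0`.
  by_cases hv : ∀ v, ι (orthogonalPart ι e v) = 0
  · rw [D₁.spectrumOn_eq_empty he hM hv, D₂.spectrumOn_eq_empty he hM hv]
  · push Not at hv
    obtain ⟨v, hv⟩ := hv
    obtain ⟨m₁, hm₁⟩ := D₁.exists_isGreatest_isLowerBound hv
    obtain ⟨m₂, hm₂⟩ := D₂.exists_isGreatest_isLowerBound hv
    rw [(D₁.isLeast_spectrumOn he hM hm₁).csInf_eq, (D₂.isLeast_spectrumOn he hM hm₂).csInf_eq]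
    exact hm₂.2 fun x => (hm₁.1 x).trans (hle x)

/-- This turns a positive gap into solvability of the Poisson equation. -/
theorem zero_notMem_spectrumOn [CompleteSpace H] (he : ‖ι e‖ = 1) {M : Submodule ℝ H}
    (hM : ∀ u, u ∈ M ↔ ⟪ι e, u⟫_ℝ = 0) (hpos : 0 < sInf (D.spectrumOn M)) :
    0 ∉ D.spectrumOn M := by
  by_cases hv : ∀ v, ι (orthogonalPart ι e v) = 0
  · simp [D.spectrumOn_eq_empty he hM hv]
  · push Not at hv
    obtain ⟨v, hv⟩ := hv
    obtain ⟨m, hm⟩ := D.exists_isGreatest_isLowerBound hv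
    have hl := D.isLeast_spectrumOn he hM hm
    rw [hl.csInf_eq] at hpos
    exact fun h => absurd (hl.2 h) (not_le.2 hpos)

end DirichletOperator

end Abstract

/-! ### Integration by parts -/

section Calculus

variable {d : ℕ}

/-- The integrand is `div(f Y)`, integrated by parts coordinate by coordinate. Compact support of
`f` suffices, so `Y` may grow arbitrarily. -/
theorem integral_fderiv_add_mul_divergence {f : E d → ℝ} {Y : E d → E d}
    (hf : ContDiff ℝ ∞ f) (hc : HasCompactSupport f) (hY : ContDiff ℝ ∞ Y) :
    Integrable (fun x => fderiv ℝ f x (Y x) + f x * divergence Y x) ∧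
      ∫ x, (fderiv ℝ f x (Y x) + f x * divergence Y x) = 0 := by
  have hYi : ∀ i, ContDiff ℝ ∞ fun x => Y x i := fun i =>
    (EuclideanSpace.proj (𝕜 := ℝ) i).contDiff.comp hY
  have hdY : ∀ i x v, fderiv ℝ (fun x => Y x i) x v = (fderiv ℝ Y x v) i := by
    intro i x v
    have h := ((EuclideanSpace.proj i : E d →L[ℝ] ℝ).hasFDerivAt.comp x
      (hY.differentiable (by simp) x).hasFDerivAt).fderiv
    exact congrArg (fun L => L v) h
  have hcf : Continuous (fderiv ℝ f) := hf.continuous_fderiv (by simp)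
  have hcY : ∀ i, Continuous (fderiv ℝ fun x => Y x i) :=
    fun i => (hYi i).continuous_fderiv (by simp)
  have hint : ∀ i, Integrable fun x => Y x i * fderiv ℝ f x (EuclideanSpace.single i 1) := by
    intro i
    refine Continuous.integrable_of_hasCompactSupport ?_ ?_
    · exact (hYi i).continuous.mul (hcf.clm_apply continuous_const)
    · exact (hc.fderiv_apply (𝕜 := ℝ) _).mul_left
  have hint' : ∀ i, Integrable fun x =>
      fderiv ℝ (fun x => Y x i) x (EuclideanSpace.single i 1) * f x := by
    intro i
    refine Continuous.integrable_of_hasCompactSupport ?_ hc.mul_left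
    exact ((hcY i).clm_apply continuous_const).mul hf.continuous
  have hpt : ∀ x, fderiv ℝ f x (Y x) + f x * divergence Y x =
      ∑ i, (Y x i * fderiv ℝ f x (EuclideanSpace.single i 1) +
        fderiv ℝ (fun x => Y x i) x (EuclideanSpace.single i 1) * f x) := by
    intro x
    have hYx : Y x = ∑ i, Y x i • EuclideanSpace.single i (1 : ℝ) := by
      have := (EuclideanSpace.basisFun (Fin d) ℝ).sum_repr (Y x)
      simpa using this.symm
    conv_lhs => rw [hYx]
    rw [map_sum, Finset.sum_add_distrib, divergence, Finset.mul_sum]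
    simp only [map_smul, smul_eq_mul, hdY, mul_comm]
  simp_rw [hpt]
  have hadd : ∀ i, Integrable fun x => Y x i * fderiv ℝ f x (EuclideanSpace.single i 1) +
      fderiv ℝ (fun x => Y x i) x (EuclideanSpace.single i 1) * f x :=
    fun i => (hint i).add (hint' i)
  refine ⟨integrable_finsetSum _ fun i _ => hadd i, ?_⟩
  rw [integral_finsetSum _ fun i _ => hadd i]
  refine Finset.sum_eq_zero fun i _ => ?_
  rw [integral_add (hint i) (hint' i), integral_mul_fderiv_eq_neg_fderiv_mul_of_integrable
    (hint' i) (hint i) ?_ (fun x _ => (hYi i).differentiable (by simp) x)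
    fun x _ => hf.differentiable (by simp) x]
  · simp
  · exact ((hYi i).continuous.mul hf.continuous).integrable_of_hasCompactSupport hc.mul_left

/-! ### Test functions, Itô generators and reversibility -/

theorem IsTest.contDiff {v : E d → ℝ} (hv : IsTest v) : ContDiff ℝ ∞ v := hv.1

theorem IsTest.hasCompactSupport_fderiv {v : E d → ℝ} (hv : IsTest v) :
    HasCompactSupport (fderiv ℝ v) := by
  obtain ⟨c, hc⟩ := hv.2
  have h : fderiv ℝ (fun x => v x - c) = fderiv ℝ v := funext fun x => fderiv_sub_const c
  exact h ▸ hc.fderiv (𝕜 := ℝ)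

theorem IsTest.contDiff_fderiv {v : E d → ℝ} (hv : IsTest v) : ContDiff ℝ ∞ (fderiv ℝ v) :=
  hv.contDiff.fderiv_right (by simp)

variable {κ : Type} [Fintype κ]

theorem IsTest.continuous_itoGenerator {b : E d → E d} {σ : κ → E d → E d} (hb : Continuous b)
    (hσ : ∀ k, Continuous (σ k)) {v : E d → ℝ} (hv : IsTest v) :
    Continuous (itoGenerator b σ v) := by
  have h1 : Continuous (fderiv ℝ v) := hv.contDiff_fderiv.continuous
  have h2 : Continuous (fderiv ℝ (fderiv ℝ v)) := hv.contDiff_fderiv.continuous_fderiv (by simp)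
  unfold itoGenerator
  exact (h1.clm_apply hb).add (continuous_const.mul (continuous_finsetSum _ fun k _ =>
    (h2.clm_apply (hσ k)).clm_apply (hσ k)))

/-- There is no zeroth-order term, so the generator vanishes wherever the test function is locally
constant. This puts its values in `L²(π)` without growth conditions on the coefficients. -/
theorem IsTest.hasCompactSupport_itoGenerator {b : E d → E d} {σ : κ → E d → E d} {v : E d → ℝ}
    (hv : IsTest v) : HasCompactSupport (itoGenerator b σ v) := by
  have h := hv.hasCompactSupport_fderiv
  refine h.mono' ?_
  intro x hx
  by_contra hxt
  have h1 : fderiv ℝ v x = 0 := image_eq_zero_of_notMem_tsupport hxt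
  have h2 : fderiv ℝ (fderiv ℝ v) x = 0 :=
    image_eq_zero_of_notMem_tsupport fun hx' => hxt (tsupport_fderiv_subset ℝ hx')
  exact hx (by simp [itoGenerator, h1, h2])

theorem IsTest.itoGenerator_add {b : E d → E d} {σ : κ → E d → E d} {v w : E d → ℝ}
    (hv : IsTest v) (hw : IsTest w) :
    itoGenerator b σ (v + w) = itoGenerator b σ v + itoGenerator b σ w := by
  have h1 : fderiv ℝ (v + w) = fderiv ℝ v + fderiv ℝ w := funext fun x =>
    fderiv_add (hv.contDiff.differentiable (by simp) x) (hw.contDiff.differentiable (by simp) x)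
  funext x
  have h2 : fderiv ℝ (fderiv ℝ v + fderiv ℝ w) x =
      fderiv ℝ (fderiv ℝ v) x + fderiv ℝ (fderiv ℝ w) x :=
    fderiv_add (hv.contDiff_fderiv.differentiable (by simp) x)
      (hw.contDiff_fderiv.differentiable (by simp) x)
  simp only [itoGenerator, h1, h2, Pi.add_apply, add_apply,
    Finset.sum_add_distrib]
  ring

theorem IsTest.itoGenerator_smul {b : E d → E d} {σ : κ → E d → E d} {v : E d → ℝ}
    (hv : IsTest v) (c : ℝ) : itoGenerator b σ (c • v) = c • itoGenerator b σ v := by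
  have h1 : fderiv ℝ (c • v) = c • fderiv ℝ v := funext fun x =>
    fderiv_const_smul (hv.contDiff.differentiable (by simp) x) c
  funext x
  have h2 : fderiv ℝ (c • fderiv ℝ v) x = c • fderiv ℝ (fderiv ℝ v) x :=
    fderiv_const_smul (hv.contDiff_fderiv.differentiable (by simp) x) c
  simp only [itoGenerator, h1, h2, Pi.smul_apply, smul_apply, smul_eq_mul,
    ← Finset.mul_sum]
  ring

theorem continuous_stratonovichDrift {f : E d → E d} {σ : κ → E d → E d} (hf : Continuous f)
    (hσ : ∀ k, ContDiff ℝ ∞ (σ k)) : Continuous (stratonovichDrift f σ) := by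
  have h : Continuous fun x => ∑ k, fderiv ℝ (σ k) x (σ k x) :=
    continuous_finsetSum _ fun k _ =>
      ((hσ k).continuous_fderiv (by simp)).clm_apply (hσ k).continuous
  exact hf.add (h.const_smul (1 / 2 : ℝ))

/-- The carré du champ `½ ∑ₖ (σₖ · ∇v) (σₖ · ∇w)` of the noise `σ`. -/
def carreDuChamp (σ : κ → E d → E d) (v w : E d → ℝ) (x : E d) : ℝ :=
  (1 / 2) * ∑ k, fderiv ℝ v x (σ k x) * fderiv ℝ w x (σ k x)

theorem IsTest.continuous_carreDuChamp {σ : κ → E d → E d} (hσ : ∀ k, Continuous (σ k))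
    {v w : E d → ℝ} (hv : IsTest v) (hw : IsTest w) : Continuous (carreDuChamp σ v w) := by
  have h1 : Continuous (fderiv ℝ v) := hv.contDiff_fderiv.continuous
  have h2 : Continuous (fderiv ℝ w) := hw.contDiff_fderiv.continuous
  unfold carreDuChamp
  exact continuous_const.mul (continuous_finsetSum _ fun k _ =>
    (h1.clm_apply (hσ k)).mul (h2.clm_apply (hσ k)))

theorem IsTest.hasCompactSupport_carreDuChamp {σ : κ → E d → E d} {v w : E d → ℝ}
    (hv : IsTest v) : HasCompactSupport (carreDuChamp σ v w) := by
  refine hv.hasCompactSupport_fderiv.mono ?_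
  intro x hx hx'
  exact hx (by simp [carreDuChamp, hx'])

/-- If `ρ f = ½ ∑ₖ div(ρ σₖ) σₖ`, then the Stratonovich equation with drift `f` and noise `σ` is
reversible with respect to `ρ`, with Dirichlet form given by the carré du champ. -/
theorem IsTest.integral_neg_itoGenerator_mul {ρ : E d → ℝ} {f : E d → E d} {σ : κ → E d → E d}
    (hρ : ContDiff ℝ ∞ ρ) (hf : Continuous f) (hσ : ∀ k, ContDiff ℝ ∞ (σ k))
    (hrev : ∀ x, (1 / 2 : ℝ) • ∑ k, divergence (fun y => ρ y • σ k y) x • σ k x = ρ x • f x)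
    {v w : E d → ℝ} (hv : IsTest v) (hw : IsTest w) :
    ∫ x, ρ x * (-(itoGenerator (stratonovichDrift f σ) σ v x) * w x) =
      ∫ x, ρ x * carreDuChamp σ v w x := by
  have hdvσ : ∀ k, ContDiff ℝ ∞ fun x => fderiv ℝ v x (σ k x) := fun k =>
    hv.contDiff_fderiv.clm_apply (hσ k)
  have hprod : ∀ k, ContDiff ℝ ∞ fun x => w x * fderiv ℝ v x (σ k x) := fun k =>
    hw.contDiff.mul (hdvσ k)
  have hcs : ∀ k, HasCompactSupport fun x => w x * fderiv ℝ v x (σ k x) := by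
    intro k
    refine hv.hasCompactSupport_fderiv.mono ?_
    intro x hx hx'
    exact hx (by simp [hx'])
  have hρσ : ∀ k, ContDiff ℝ ∞ fun x => ρ x • σ k x := fun k => hρ.smul (hσ k)
  -- The divergence theorem is applied to `w (σₖ · ∇v) ρ σₖ`; compact support comes from `∇v`, since
  -- `w` may be a nonzero constant at infinity.
  have hibp := fun k => integral_fderiv_add_mul_divergence (hprod k) (hcs k) (hρσ k)
  have hder : ∀ k x, fderiv ℝ (fun x => w x * fderiv ℝ v x (σ k x)) x (ρ x • σ k x) =
      ρ x * (fderiv ℝ v x (σ k x) * fderiv ℝ w x (σ k x) +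
        w x * (fderiv ℝ (fderiv ℝ v) x (σ k x) (σ k x) +
          fderiv ℝ v x (fderiv ℝ (σ k) x (σ k x)))) := by
    intro k x
    have h1 : HasFDerivAt (fun x => fderiv ℝ v x (σ k x)) _ x :=
      (hv.contDiff_fderiv.differentiable (by simp) x).hasFDerivAt.clm_apply
        ((hσ k).differentiable (by simp) x).hasFDerivAt
    have h2 := (hw.contDiff.differentiable (by simp) x).hasFDerivAt.mul h1
    have h3 : fderiv ℝ (fun x => w x * fderiv ℝ v x (σ k x)) x = _ := h2.fderiv
    rw [h3]
    simp only [map_smul, add_apply, smul_apply, smul_eq_mul, ContinuousLinearMap.comp_apply,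
      ContinuousLinearMap.flip_apply]
    ring
  -- Differentiating `σₖ` inside `σₖ · ∇v` produces exactly the Stratonovich correction, and `hrev`
  -- turns the divergence terms into the drift term `ρ w (f · ∇v)`.
  have hpt : ∀ x, ∑ k, (1 / 2 : ℝ) * (fderiv ℝ (fun x => w x * fderiv ℝ v x (σ k x)) x
      (ρ x • σ k x) + w x * fderiv ℝ v x (σ k x) * divergence (fun y => ρ y • σ k y) x) =
      ρ x * carreDuChamp σ v w x -
        ρ x * (-(itoGenerator (stratonovichDrift f σ) σ v x) * w x) := by
    intro x
    have h1 := congrArg (fderiv ℝ v x) (hrev x)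
    simp only [map_smul, map_sum, smul_eq_mul] at h1
    simp only [hder, carreDuChamp, itoGenerator, stratonovichDrift, map_add, map_smul, map_sum,
      smul_eq_mul]
    have h2 : ∑ k, (1 / 2 : ℝ) * (ρ x * (fderiv ℝ v x (σ k x) * fderiv ℝ w x (σ k x) +
        w x * (fderiv ℝ (fderiv ℝ v) x (σ k x) (σ k x) +
          fderiv ℝ v x (fderiv ℝ (σ k) x (σ k x)))) +
        w x * fderiv ℝ v x (σ k x) * divergence (fun y => ρ y • σ k y) x) =
        (1 / 2) * ρ x * ∑ k, fderiv ℝ v x (σ k x) * fderiv ℝ w x (σ k x) +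
        (1 / 2) * ρ x * w x * ∑ k, fderiv ℝ (fderiv ℝ v) x (σ k x) (σ k x) +
        (1 / 2) * ρ x * w x * ∑ k, fderiv ℝ v x (fderiv ℝ (σ k) x (σ k x)) +
        (1 / 2) * w x * ∑ k, divergence (fun y => ρ y • σ k y) x * fderiv ℝ v x (σ k x) := by
      simp only [Finset.mul_sum, ← Finset.sum_add_distrib]
      exact Finset.sum_congr rfl fun k _ => by ring
    rw [h2]
    linear_combination w x * h1
  have hbc := continuous_stratonovichDrift hf hσ
  have hi1 : Integrable fun x => ρ x * carreDuChamp σ v w x :=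
    (hρ.continuous.mul (hv.continuous_carreDuChamp (fun k => (hσ k).continuous)
      hw)).integrable_of_hasCompactSupport hv.hasCompactSupport_carreDuChamp.mul_left
  have hi2 : Integrable fun x =>
      ρ x * (-(itoGenerator (stratonovichDrift f σ) σ v x) * w x) := by
    refine Continuous.integrable_of_hasCompactSupport ?_ ?_
    · exact hρ.continuous.mul ((hv.continuous_itoGenerator hbc
        fun k => (hσ k).continuous).neg.mul hw.contDiff.continuous)
    · refine hv.hasCompactSupport_itoGenerator (b := stratonovichDrift f σ) (σ := σ) |>.mono ?_
      intro x hx hx'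
      exact hx (by simp [hx'])
  have h0 : ∫ x, (ρ x * carreDuChamp σ v w x -
      ρ x * (-(itoGenerator (stratonovichDrift f σ) σ v x) * w x)) = 0 := by
    simp_rw [← hpt]
    rw [integral_finsetSum _ fun k _ => (hibp k).1.const_mul (1 / 2)]
    refine Finset.sum_eq_zero fun k _ => ?_
    rw [integral_const_mul, (hibp k).2, mul_zero]
  rw [integral_sub hi1 hi2] at h0
  linarith

end Calculus

/-! ### The generators in `L²(π)` -/

section Realization

open scoped InnerProductSpace

variable {d : ℕ}

theorem isTest_const (c : ℝ) : IsTest fun _ : E d => c :=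
  by
  refine ⟨contDiff_const, c, ?_⟩
  simp only [sub_self]
  exact HasCompactSupport.zero

theorem IsTest.add {v w : E d → ℝ} (hv : IsTest v) (hw : IsTest w) : IsTest (v + w) := by
  obtain ⟨c, hc⟩ := hv.2
  obtain ⟨c', hc'⟩ := hw.2
  refine ⟨hv.1.add hw.1, c + c', ?_⟩
  have h : (fun x => (v + w) x - (c + c')) = (fun x => v x - c) + fun x => w x - c' := by
    funext x
    simp only [Pi.add_apply]
    ring
  rw [h]
  exact hc.add hc'

theorem IsTest.smul {v : E d → ℝ} (hv : IsTest v) (r : ℝ) : IsTest (r • v) := by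
  obtain ⟨c, hc⟩ := hv.2
  refine ⟨contDiff_const.smul hv.1, r * c, ?_⟩
  have h : HasCompactSupport fun x => r * (v x - c) := hc.mul_left
  convert h using 1
  funext x
  simp only [Pi.smul_apply, smul_eq_mul]
  ring

/-- The space of test functions. -/
def testSpace (d : ℕ) : Submodule ℝ (E d → ℝ) where
  carrier := {v | IsTest v}
  zero_mem' := isTest_const 0
  add_mem' := IsTest.add
  smul_mem' := fun r _ hv => hv.smul r

/-- The constant test function `1`. -/
def testOne (d : ℕ) : testSpace d := ⟨fun _ => 1, isTest_const 1⟩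

variable {π : Measure (E d)} [IsFiniteMeasure π]

theorem IsTest.memLp {v : E d → ℝ} (hv : IsTest v) : MemLp v 2 π := by
  obtain ⟨c, hc⟩ := hv.2
  have h1 : MemLp (fun x => v x - c) 2 π :=
    (hv.1.continuous.sub continuous_const).memLp_of_hasCompactSupport hc
  have h2 := h1.add (memLp_const (μ := π) (p := 2) c)
  convert h2 using 1
  funext x
  simp

variable (π) in
/-- The inclusion of the test functions in `L²(π)`. -/
def testToLp : testSpace d →ₗ[ℝ] Lp ℝ 2 π where
  toFun v := (IsTest.memLp v.2).toLp v
  map_add' _ _ := rfl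
  map_smul' _ _ := rfl

theorem coeFn_testToLp (v : testSpace d) : testToLp π v =ᵐ[π] (v : E d → ℝ) :=
  MemLp.coeFn_toLp (IsTest.memLp v.2)

variable {κ : Type} [Fintype κ] {b : E d → E d} {σ : κ → E d → E d}

theorem IsTest.memLp_neg_itoGenerator (hb : Continuous b) (hσ : ∀ k, Continuous (σ k))
    {v : E d → ℝ} (hv : IsTest v) : MemLp (-itoGenerator b σ v) 2 π :=
  ((hv.continuous_itoGenerator hb hσ).memLp_of_hasCompactSupport
    hv.hasCompactSupport_itoGenerator).neg

variable (π) in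
/-- The negative of the generator, from test functions to `L²(π)`. -/
def negGeneratorToLp (hb : Continuous b) (hσ : ∀ k, Continuous (σ k)) :
    testSpace d →ₗ[ℝ] Lp ℝ 2 π where
  toFun v := (IsTest.memLp_neg_itoGenerator hb hσ v.2).toLp _
  map_add' v w := by
    rw [← MemLp.toLp_add]
    congr 1
    rw [Submodule.coe_add, IsTest.itoGenerator_add v.2 w.2, neg_add]
  map_smul' c v := by
    rw [RingHom.id_apply, ← MemLp.toLp_const_smul]
    congr 1
    rw [Submodule.coe_smul, IsTest.itoGenerator_smul v.2, smul_neg]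

theorem coeFn_negGeneratorToLp (hb : Continuous b) (hσ : ∀ k, Continuous (σ k))
    (v : testSpace d) :
    negGeneratorToLp π hb hσ v =ᵐ[π] -itoGenerator b σ (v : E d → ℝ) :=
  MemLp.coeFn_toLp (IsTest.memLp_neg_itoGenerator hb hσ v.2)

theorem inner_negGeneratorToLp (hb : Continuous b) (hσ : ∀ k, Continuous (σ k))
    (v w : testSpace d) : ⟪negGeneratorToLp π hb hσ v, testToLp π w⟫_ℝ =
      ∫ x, -(itoGenerator b σ v x) * (w : E d → ℝ) x ∂π := by
  rw [L2.inner_def]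
  refine integral_congr_ae ?_
  filter_upwards [coeFn_negGeneratorToLp (π := π) hb hσ v, coeFn_testToLp (π := π) w]
    with x h1 h2
  rw [h1, h2]
  simp [mul_comm]

theorem carreDuChamp_comm (v w : E d → ℝ) : carreDuChamp σ v w = carreDuChamp σ w v := by
  funext x
  simp only [carreDuChamp, mul_comm]

theorem carreDuChamp_self_nonneg (v : E d → ℝ) (x : E d) : 0 ≤ carreDuChamp σ v v x :=
  mul_nonneg (by norm_num) (Finset.sum_nonneg fun _ _ => mul_self_nonneg _)

variable (π) in
/-- The Dirichlet operator of a reversible diffusion. -/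
def dirichletOperator (hb : Continuous b) (hσ : ∀ k, Continuous (σ k))
    (hrev : ∀ v w, IsTest v → IsTest w →
      ∫ x, -(itoGenerator b σ v x) * w x ∂π = ∫ x, carreDuChamp σ v w x ∂π) :
    DirichletOperator (testToLp π) (testOne d) where
  toLinearMap := negGeneratorToLp π hb hσ
  symm v w := by
    rw [real_inner_comm (negGeneratorToLp π hb hσ w), inner_negGeneratorToLp,
      inner_negGeneratorToLp, hrev _ _ v.2 w.2, hrev _ _ w.2 v.2, carreDuChamp_comm]
  nonneg v := by
    rw [inner_negGeneratorToLp, hrev _ _ v.2 v.2]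
    exact integral_nonneg fun x => carreDuChamp_self_nonneg _ x
  map_one := by
    have h : -itoGenerator b σ (testOne d : E d → ℝ) = 0 := by
      funext x
      simp [itoGenerator, testOne]
    change (IsTest.memLp_neg_itoGenerator hb hσ (testOne d).2).toLp _ = 0
    simp only [h]
    exact MemLp.toLp_zero _

/-- This brings the concrete Friedrichs extension under the abstract comparison results. -/
theorem generatorGraph_eq (hb : Continuous b) (hσ : ∀ k, Continuous (σ k))
    (hrev : ∀ v w, IsTest v → IsTest w →
      ∫ x, -(itoGenerator b σ v x) * w x ∂π = ∫ x, carreDuChamp σ v w x ∂π) :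
    generatorGraph π (itoGenerator b σ) = (dirichletOperator π hb hσ hrev).graph := by
  have htend : ∀ (v : ℕ → testSpace d) (u : Lp ℝ 2 π),
      Tendsto (fun n => testToLp π (v n)) atTop (𝓝 u) ↔
        Tendsto (fun n => eLpNorm (fun x => (v n : E d → ℝ) x - u x) 2 π) atTop (𝓝 0) := by
    intro v u
    rw [Lp.tendsto_Lp_iff_tendsto_eLpNorm']
    refine tendsto_congr fun n => eLpNorm_congr_ae ?_
    filter_upwards [coeFn_testToLp (π := π) (v n)] with x hx
    simp [hx]
  have henergy : ∀ v w : testSpace d, energy π (itoGenerator b σ)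
      (fun x => (v : E d → ℝ) x - (w : E d → ℝ) x) =
      ⟪(dirichletOperator π hb hσ hrev).toLinearMap (v - w), testToLp π (v - w)⟫_ℝ := by
    intro v w
    exact (inner_negGeneratorToLp hb hσ (v - w) (v - w)).symm
  -- The sign on the right arises because the Dirichlet operator is the negative of the generator.
  have hweak : ∀ (p : Lp ℝ 2 π × Lp ℝ 2 π) (v : testSpace d),
      (∫ x, p.1 x * itoGenerator b σ v x ∂π = ∫ x, p.2 x * (v : E d → ℝ) x ∂π) ↔
        ⟪p.1, (dirichletOperator π hb hσ hrev).toLinearMap v⟫_ℝ = -⟪p.2, testToLp π v⟫_ℝ := by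
    intro p v
    have h1 : ⟪p.1, (dirichletOperator π hb hσ hrev).toLinearMap v⟫_ℝ =
        -∫ x, p.1 x * itoGenerator b σ v x ∂π := by
      rw [L2.inner_def, ← integral_neg]
      refine integral_congr_ae ?_
      filter_upwards [coeFn_negGeneratorToLp (π := π) hb hσ v] with x hx
      change ⟪p.1 x, negGeneratorToLp π hb hσ v x⟫_ℝ = _
      rw [hx]
      simp [mul_comm]
    have h2 : ⟪p.2, testToLp π v⟫_ℝ = ∫ x, p.2 x * (v : E d → ℝ) x ∂π := by
      rw [L2.inner_def]
      refine integral_congr_ae ?_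
      filter_upwards [coeFn_testToLp (π := π) v] with x hx
      rw [hx]
      simp [mul_comm]
    rw [h1, h2, neg_inj]
  ext p
  constructor
  · rintro ⟨⟨v, hv, hvu, hE⟩, hw⟩
    refine ⟨⟨fun n => ⟨v n, hv n⟩, (htend _ _).2 hvu, ?_⟩, fun x => (hweak p x).1 (hw x x.2)⟩
    exact hE.congr fun q => henergy ⟨v q.1, hv q.1⟩ ⟨v q.2, hv q.2⟩
  · rintro ⟨⟨v, hvu, hE⟩, hw⟩
    refine ⟨⟨fun n => v n, fun n => (v n).2, (htend _ _).1 hvu, ?_⟩,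
      fun x hx => (hweak p ⟨x, hx⟩).2 (hw ⟨x, hx⟩)⟩
    exact hE.congr fun q => (henergy (v q.1) (v q.2)).symm

theorem mem_meanZero_iff (u : Lp ℝ 2 π) :
    u ∈ meanZero π ↔ ⟪testToLp π (testOne d), u⟫_ℝ = 0 := by
  have h : ⟪testToLp π (testOne d), u⟫_ℝ = ∫ x, u x ∂π := by
    rw [L2.inner_def]
    refine integral_congr_ae ?_
    filter_upwards [coeFn_testToLp (π := π) (testOne d)] with x hx
    rw [hx]
    simp [testOne]
  rw [h]
  rfl

theorem norm_testToLp_testOne {π : Measure (E d)} [IsProbabilityMeasure π] :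
    ‖testToLp π (testOne d)‖ = 1 := by
  change ‖(IsTest.memLp (testOne d).2).toLp _‖ = 1
  rw [Lp.norm_toLp]
  have h : eLpNorm (testOne d : E d → ℝ) 2 π = 1 := by
    change eLpNorm (fun _ => (1 : ℝ)) 2 π = 1
    rw [eLpNorm_const _ (by norm_num) (NeZero.ne π)]
    simp
  rw [h, ENNReal.toReal_one]

theorem centred_mem_meanZero {π : Measure (E d)} [IsProbabilityMeasure π] (φ : Lp ℝ 2 π) :
    centred π φ ∈ meanZero π := by
  change ∫ x, centred π φ x ∂π = 0
  have h : centred π φ =ᵐ[π] fun x => φ x - ∫ y, φ y ∂π := by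
    filter_upwards [Lp.coeFn_sub φ (Lp.const 2 π (∫ x, φ x ∂π)),
      Lp.coeFn_const (p := 2) (μ := π) (∫ x, φ x ∂π)] with x h1 h2
    rw [centred, h1, Pi.sub_apply, h2]
    rfl
  rw [integral_congr_ae h, integral_sub ((Lp.memLp φ).integrable (by norm_num))
    (integrable_const _)]
  simp

/-- The inverse at `0` supplies the solution, and the equivalence in the definition of the spectrum
makes it the only mean-zero one. -/
theorem existsUnique_hasAsymptoticVariance {π : Measure (E d)} [IsProbabilityMeasure π]
    {G : Set (Lp ℝ 2 π × Lp ℝ 2 π)} (hG : 0 ∉ meanZeroSpectrum π G) (φ : Lp ℝ 2 π) :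
    ∃! s, HasAsymptoticVariance π G φ s := by
  obtain ⟨R, hR⟩ := not_not.1 hG
  simp only [zero_smul, sub_zero] at hR
  let h : meanZero π := ⟨centred π φ, centred_mem_meanZero φ⟩
  obtain ⟨w, hw, hwh⟩ := (hR (R h) h).1 rfl
  refine ⟨_, ⟨R h, (R h).2, w, hw, hwh, rfl⟩, ?_⟩
  rintro s ⟨ψ, hψ, w', hw', hwh', rfl⟩
  have h1 := (hR ⟨ψ, hψ⟩ h).2 ⟨w', hw', hwh'⟩
  rw [h1]

end Realization

/-! ### The Gibbs measure and the two dynamics -/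

section Gibbs

variable {d : ℕ} {V : E d → ℝ}

theorem integral_exp_neg_pos (hZ : Integrable fun x => Real.exp (-V x)) :
    0 < ∫ x, Real.exp (-V x) := by
  rw [integral_pos_iff_support_of_nonneg (fun x => (Real.exp_pos _).le) hZ]
  have h : Function.support (fun x => Real.exp (-V x)) = Set.univ :=
    Set.eq_univ_of_forall fun x => (Real.exp_pos _).ne'
  rw [h]
  exact Measure.measure_univ_pos.2 (NeZero.ne _)

theorem contDiff_gibbsDensity (hV : ContDiff ℝ ∞ V) : ContDiff ℝ ∞ (gibbsDensity V) :=
  contDiff_const.mul (Real.contDiff_exp.comp hV.neg)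

theorem gibbsDensity_nonneg (x : E d) : 0 ≤ gibbsDensity V x :=
  mul_nonneg (inv_nonneg.2 (integral_nonneg fun _ => (Real.exp_pos _).le)) (Real.exp_pos _).le

theorem isProbabilityMeasure_gibbsMeasure (hZ : Integrable fun x => Real.exp (-V x)) :
    IsProbabilityMeasure (gibbsMeasure V) := by
  constructor
  have hi : Integrable (gibbsDensity V) := hZ.const_mul _
  rw [gibbsMeasure, withDensity_apply _ MeasurableSet.univ, Measure.restrict_univ,
    ← ofReal_integral_eq_lintegral_ofReal hi (ae_of_all _ gibbsDensity_nonneg)]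
  simp only [gibbsDensity]
  rw [integral_const_mul, inv_mul_cancel₀ (integral_exp_neg_pos hZ).ne', ENNReal.ofReal_one]

theorem integral_gibbsMeasure (hV : ContDiff ℝ ∞ V) (f : E d → ℝ) :
    ∫ x, f x ∂gibbsMeasure V = ∫ x, gibbsDensity V x * f x := by
  rw [gibbsMeasure, integral_withDensity_eq_integral_toReal_smul
    (contDiff_gibbsDensity hV).continuous.measurable.ennreal_ofReal
    (ae_of_all _ fun _ => ENNReal.ofReal_lt_top)]
  simp only [ENNReal.toReal_ofReal (gibbsDensity_nonneg _), smul_eq_mul]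

theorem fderiv_gibbsDensity (hV : ContDiff ℝ ∞ V) (x : E d) :
    fderiv ℝ (gibbsDensity V) x = -gibbsDensity V x • fderiv ℝ V x := by
  have h1 : HasFDerivAt (fun x => Real.exp (-V x)) (Real.exp (-V x) • -fderiv ℝ V x) x :=
    ((hV.differentiable (by simp) x).hasFDerivAt.neg).exp
  have h2 : HasFDerivAt (gibbsDensity V) _ x := h1.const_mul (∫ y, Real.exp (-V y))⁻¹
  rw [h2.fderiv, gibbsDensity]
  module

theorem continuous_gradient (hV : ContDiff ℝ ∞ V) : Continuous (gradient V) :=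
  (InnerProductSpace.toDual ℝ (E d)).symm.continuous.comp (hV.continuous_fderiv (by simp))

/-- The noise is constant, so only the density is differentiated, and `∂ₖρ = -ρ ∂ₖV`. -/
theorem divergence_smul_langevinNoise (hV : ContDiff ℝ ∞ V) (k : Fin d) (x : E d) :
    divergence (fun y => gibbsDensity V y • langevinNoise d k y) x =
      -(gibbsDensity V x * √2 * gradient V x k) := by
  have hgrad : fderiv ℝ V x (EuclideanSpace.single k 1) = gradient V x k := by
    have h : fderiv ℝ V x (EuclideanSpace.single k 1) =
        inner ℝ (gradient V x) (EuclideanSpace.single k 1) := by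
      simp [gradient]
    rw [h, EuclideanSpace.inner_single_right]
    simp
  have h1 : HasFDerivAt (fun y => gibbsDensity V y • langevinNoise d k y) _ x :=
    (((contDiff_gibbsDensity hV).differentiable (by simp) x).hasFDerivAt).smul_const
      (√2 • EuclideanSpace.single k (1 : ℝ))
  rw [divergence, h1.fderiv, fderiv_gibbsDensity hV]
  rw [Finset.sum_eq_single k]
  · simp [hgrad]
    ring
  · intro i _ hik
    simp [hik]
  · simp

/-- This is the reversibility condition for the drift `-∇V`; the two factors `√2` cancel the `½`. -/
theorem sum_divergence_langevinNoise (hV : ContDiff ℝ ∞ V) (x : E d) :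
    (1 / 2 : ℝ) • ∑ k, divergence (fun y => gibbsDensity V y • langevinNoise d k y) x •
      langevinNoise d k x = gibbsDensity V x • -gradient V x := by
  have h2 : √2 * √2 = 2 := Real.mul_self_sqrt (by norm_num)
  have h := (EuclideanSpace.basisFun (Fin d) ℝ).sum_repr (gradient V x)
  simp only [EuclideanSpace.basisFun_repr, EuclideanSpace.basisFun_apply] at h
  conv_rhs => rw [← h]
  rw [← Finset.sum_neg_distrib, Finset.smul_sum, Finset.smul_sum]
  refine Finset.sum_congr rfl fun k _ => ?_
  rw [divergence_smul_langevinNoise hV, langevinNoise, smul_smul, smul_smul, ← neg_smul, smul_smul]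
  congr 1
  linear_combination (-(1 / 2) * gibbsDensity V x * gradient V x k) * h2

theorem stratonovichDrift_langevinNoise (f : E d → E d) :
    stratonovichDrift f (langevinNoise d) = f := by
  funext x
  have h : ∀ k, fderiv ℝ (langevinNoise d k) x = 0 := fun k => fderiv_const_apply _
  simp [stratonovichDrift, h]

theorem contDiff_langevinNoise (k : Fin d) : ContDiff ℝ ∞ (langevinNoise d k) := contDiff_const

theorem contDiff_perturbedNoise {g : E d → E d} (hg : ContDiff ℝ ∞ g) :
    ∀ k, ContDiff ℝ ∞ (perturbedNoise g k)
  | none => hg.const_smul √2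
  | some k => contDiff_langevinNoise k

/-- Here `div(g π) = 0` enters: the column `√2 g` contributes nothing, so the same drift `-∇V` stays
reversible. -/
theorem sum_divergence_perturbedNoise (hV : ContDiff ℝ ∞ V) {g : E d → E d}
    (hg : ContDiff ℝ ∞ g) (hdiv : ∀ x, divergence (fun y => gibbsDensity V y • g y) x = 0)
    (x : E d) :
    (1 / 2 : ℝ) • ∑ k, divergence (fun y => gibbsDensity V y • perturbedNoise g k y) x •
      perturbedNoise g k x = gibbsDensity V x • -gradient V x := by
  have h0 : divergence (fun y => gibbsDensity V y • perturbedNoise g none y) x = 0 := by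
    have h1 : (fun y => gibbsDensity V y • perturbedNoise g none y) =
        fun y => √2 • (gibbsDensity V y • g y) := by
      funext y
      exact smul_comm _ _ _
    have h2 : DifferentiableAt ℝ (fun y => gibbsDensity V y • g y) x :=
      ((contDiff_gibbsDensity hV).smul hg).differentiable (by simp) x
    rw [h1, divergence, fderiv_fun_const_smul h2]
    have h3 := hdiv x
    rw [divergence] at h3
    simp [← Finset.mul_sum, h3]
  rw [Fintype.sum_option, h0, zero_smul, zero_add]
  exact sum_divergence_langevinNoise hV x

theorem integral_neg_langevin_mul (hV : ContDiff ℝ ∞ V) (v w : E d → ℝ) (hv : IsTest v)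
    (hw : IsTest w) :
    ∫ x, -(itoGenerator (fun x => -gradient V x) (langevinNoise d) v x) * w x ∂gibbsMeasure V =
      ∫ x, carreDuChamp (langevinNoise d) v w x ∂gibbsMeasure V := by
  have h := hv.integral_neg_itoGenerator_mul (contDiff_gibbsDensity hV)
    (continuous_gradient hV).neg contDiff_langevinNoise (sum_divergence_langevinNoise hV) hw
  rw [stratonovichDrift_langevinNoise] at h
  rw [integral_gibbsMeasure hV, integral_gibbsMeasure hV]
  exact h

theorem integral_neg_perturbed_mul (hV : ContDiff ℝ ∞ V) {g : E d → E d}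
    (hg : ContDiff ℝ ∞ g) (hdiv : ∀ x, divergence (fun y => gibbsDensity V y • g y) x = 0)
    (v w : E d → ℝ) (hv : IsTest v) (hw : IsTest w) :
    ∫ x, -(itoGenerator (stratonovichDrift (fun x => -gradient V x) (perturbedNoise g))
      (perturbedNoise g) v x) * w x ∂gibbsMeasure V =
      ∫ x, carreDuChamp (perturbedNoise g) v w x ∂gibbsMeasure V := by
  rw [integral_gibbsMeasure hV, integral_gibbsMeasure hV]
  exact hv.integral_neg_itoGenerator_mul (contDiff_gibbsDensity hV)
    (continuous_gradient hV).neg (contDiff_perturbedNoise hg)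
    (sum_divergence_perturbedNoise hV hg hdiv) hw

/-- The column `none` adds `½ (√2 g · ∇v)² = (g · ∇v)²`. -/
theorem carreDuChamp_langevinNoise_le (g : E d → E d) (v : E d → ℝ) (x : E d) :
    carreDuChamp (langevinNoise d) v v x ≤ carreDuChamp (perturbedNoise g) v v x := by
  rw [carreDuChamp, carreDuChamp, Fintype.sum_option, mul_add]
  exact le_add_of_nonneg_left (mul_nonneg (by norm_num) (mul_self_nonneg _))

theorem IsTest.integrable_carreDuChamp {κ : Type} [Fintype κ] {π : Measure (E d)}
    [IsFiniteMeasure π] {σ : κ → E d → E d} (hσ : ∀ k, Continuous (σ k)) {v w : E d → ℝ}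
    (hv : IsTest v) (hw : IsTest w) : Integrable (carreDuChamp σ v w) π :=
  (hv.continuous_carreDuChamp hσ hw).integrable_of_hasCompactSupport
    hv.hasCompactSupport_carreDuChamp

end Gibbs

end StratonovichLangevin

end

/-! ### Comparison of the two dynamics -/

theorem theorem3 (d : ℕ) (V : StratonovichLangevin.E d → ℝ)
    (g : StratonovichLangevin.E d → StratonovichLangevin.E d)
    (hV : ContDiff ℝ ∞ V) (hZ : Integrable fun x => Real.exp (-V x))
    (hg : ContDiff ℝ ∞ g)
    (hdiv : ∀ x, StratonovichLangevin.divergence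
      (fun y => StratonovichLangevin.gibbsDensity V y • g y) x = 0) :
    StratonovichLangevin.spectralGap (StratonovichLangevin.gibbsMeasure V)
        (StratonovichLangevin.langevinGraph V) ≤
      StratonovichLangevin.spectralGap (StratonovichLangevin.gibbsMeasure V)
        (StratonovichLangevin.perturbedGraph V g) ∧
    ∀ φ : Lp ℝ 2 (StratonovichLangevin.gibbsMeasure V),
      (∀ sL sS : ℝ,
        StratonovichLangevin.HasAsymptoticVariance (StratonovichLangevin.gibbsMeasure V)
          (StratonovichLangevin.langevinGraph V) φ sL →
        StratonovichLangevin.HasAsymptoticVariance (StratonovichLangevin.gibbsMeasure V)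
          (StratonovichLangevin.perturbedGraph V g) φ sS →
        sL ≥ sS) ∧
      (0 < StratonovichLangevin.spectralGap (StratonovichLangevin.gibbsMeasure V)
          (StratonovichLangevin.langevinGraph V) →
        (∃! sL : ℝ,
          StratonovichLangevin.HasAsymptoticVariance (StratonovichLangevin.gibbsMeasure V)
            (StratonovichLangevin.langevinGraph V) φ sL) ∧
        (∃! sS : ℝ,
          StratonovichLangevin.HasAsymptoticVariance (StratonovichLangevin.gibbsMeasure V)
            (StratonovichLangevin.perturbedGraph V g) φ sS)) := by
  have := StratonovichLangevin.isProbabilityMeasure_gibbsMeasure hZ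
  have hcL := fun k => (StratonovichLangevin.contDiff_langevinNoise (d := d) k).continuous
  have hcS := fun k => (StratonovichLangevin.contDiff_perturbedNoise hg k).continuous
  have hbL : Continuous fun x => -gradient V x := (StratonovichLangevin.continuous_gradient hV).neg
  have hbS := StratonovichLangevin.continuous_stratonovichDrift hbL
    (StratonovichLangevin.contDiff_perturbedNoise hg)
  have hrL := StratonovichLangevin.integral_neg_langevin_mul hV
  have hrS := StratonovichLangevin.integral_neg_perturbed_mul hV hg hdiv
  have hGL : StratonovichLangevin.langevinGraph V = _ :=
    StratonovichLangevin.generatorGraph_eq hbL hcL hrL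
  have hGS : StratonovichLangevin.perturbedGraph V g = _ :=
    StratonovichLangevin.generatorGraph_eq hbS hcS hrS
  set DL := StratonovichLangevin.dirichletOperator (StratonovichLangevin.gibbsMeasure V) hbL hcL hrL
  set DS := StratonovichLangevin.dirichletOperator (StratonovichLangevin.gibbsMeasure V) hbS hcS hrS
  have he := StratonovichLangevin.norm_testToLp_testOne (π := StratonovichLangevin.gibbsMeasure V)
  have hM := StratonovichLangevin.mem_meanZero_iff (π := StratonovichLangevin.gibbsMeasure V)
  have hle : ∀ v, inner ℝ (DL.toLinearMap v)
        (StratonovichLangevin.testToLp (StratonovichLangevin.gibbsMeasure V) v) ≤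
      inner ℝ (DS.toLinearMap v)
        (StratonovichLangevin.testToLp (StratonovichLangevin.gibbsMeasure V) v) := by
    intro v
    have h1 := StratonovichLangevin.inner_negGeneratorToLp
      (π := StratonovichLangevin.gibbsMeasure V) hbL hcL v v
    have h2 := StratonovichLangevin.inner_negGeneratorToLp
      (π := StratonovichLangevin.gibbsMeasure V) hbS hcS v v
    rw [hrL _ _ v.2 v.2] at h1
    rw [hrS _ _ v.2 v.2] at h2
    refine h1.trans_le (le_of_le_of_eq ?_ h2.symm)
    exact integral_mono (StratonovichLangevin.IsTest.integrable_carreDuChamp hcL v.2 v.2)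
      (StratonovichLangevin.IsTest.integrable_carreDuChamp hcS v.2 v.2)
      fun x => StratonovichLangevin.carreDuChamp_langevinNoise_le g _ x
  rw [hGL, hGS]
  have hgap : StratonovichLangevin.spectralGap (StratonovichLangevin.gibbsMeasure V) DL.graph ≤
      StratonovichLangevin.spectralGap (StratonovichLangevin.gibbsMeasure V) DS.graph :=
    -- `meanZeroSpectrum` of `D.graph` agrees with `D.spectrumOn` by definition.
    StratonovichLangevin.DirichletOperator.sInf_spectrumOn_le he hM hle
  refine ⟨hgap, fun φ => ⟨?_, fun hpos => ⟨?_, ?_⟩⟩⟩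
  · rintro _ _ ⟨ψ₁, hψ₁, w₁, h₁, hw₁, rfl⟩ ⟨ψ₂, hψ₂, w₂, h₂, hw₂, rfl⟩
    -- Both Poisson equations have the same right-hand side, so the two inverse forms are compared
    -- at one vector.
    obtain rfl : w₁ = w₂ := neg_injective (hw₁.trans hw₂.symm)
    rw [← hw₁]
    exact StratonovichLangevin.DirichletOperator.inner_le_inner_of_form_le hle h₁ h₂
      ((hM _).1 hψ₁) ((hM _).1 hψ₂)
  · exact StratonovichLangevin.existsUnique_hasAsymptoticVariance
      (DL.zero_notMem_spectrumOn he hM hpos) φ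
  · exact StratonovichLangevin.existsUnique_hasAsymptoticVariance
      (DS.zero_notMem_spectrumOn he hM (hpos.trans_le hgap)) φ
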